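/- Let $\mathbb{R}^d$ carry an arbitrary fixed norm $|\cdot|$, and let $\mathcal{K}(\mathbb{R}^d)$ be the set of non-empty compact subsets of $\mathbb{R}^d$ with the Hausdorff metric $\mathrm{haus}$. Let $F:[0,1]\to\mathcal{K}(\mathbb{R}^d)$ be of bounded variation with respect to $\mathrm{haus}$ and have a compact graph $\{(t,y): t\in[0,1],\ y\in F(t)\}$. For $A,B\in\mathcal{K}(\mathbb{R}^d)$, a pair $(p,q)\in A\times B$ is called a metric pair of $A,B$ if $|p-q|=\mathrm{dist}(q,A)$ or $|p-q|=\mathrm{dist}(p,B)$; a metric chain of $A_0,\dots,A_{m-1}$ is a tuple $(y_0,\dots,y_{m-1})$ with $y_i\in A_i$ for all $i$ such that every $(y_i,y_{i+1})$ is a metric pair of $A_i,A_{i+1}$. For a partition $\chi$: $0=t_0<\dots<t_m=1$ with norm $|\chi|=\max_i(t_{i+1}-t_i)$ and a weight $\kappa:[0,1]\to\mathbb{R}$, put $$S_{\chi,\kappa}F=\Big\{\sum_{i=0}^{m-1}(t_{i+1}-t_i)\,\kappa(t_i)\,y_i \;:\; (y_0,\dots,y_{m-1})\text{ is a metric chain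 of }F(t_0),\dots,F(t_{m-1})\Big\}.$$ The weighted metric integral of $F$ with weight $\kappa$ is the upper Kuratowski limit of $S_{\chi,\kappa}F$ as $|\chi|\to0$, i.e. the set of all limits of convergent sequences $v_k\in S_{\chi_k,\kappa}F$ with $|\chi_k|\to 0$. With $p_{n,k}(x)=\binom nk x^k(1-x)^{n-k}$, let $T_nF(x)$, for $n\in\mathbb{N}$ and $x\in[0,1]$, be the weighted metric integral of $F$ with weight $\kappa=\mathcal{K}_n(x,\cdot)$, where either $$\mathcal{K}_n(x,t)=(n+1)\sum_{k=0}^n p_{n,k}(x)\,p_{n,k}(t)\quad\text{(Bernstein–Durrmeyer operator)}$$ or $$\mathcal{K}_n(x,t)=(n+1)\sum_{k=0}^n p_{n,k}(x)\,\chi_{\left[\frac{k}{n+1},\frac{k+1}{n+1}\right]}(t)\quad\text{(Kantorovich operator)},$$ and $\chi_I$ denotes the characteristic function of $I$. Let $x\in[0,1]$ and suppose that $F$ is locally Lipschitz around $x$: there are $L>0$ and $\delta>0$ such that $\mathrm{haus}(F(x_1),F(x_2))\le L|x_1-x_2|$ for all $x_1,x_2\in(x-\delta/2,x+\delta/2)\cap[0,1]$.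 Then, for both choices of $T_n$, the set $T_nF(x)$ is non-empty and compact for every $n\ge1$, and $$\mathrm{haus}\big(T_nF(x),F(x)\big)=O\!\left(\frac1{\sqrt n}\right),\qquad n\to\infty.$$ -/

import Mathlib

open Set Filter Topology Metric TopologicalSpace

noncomputable section

namespace MetricApprox

variable {E : Type*} [NormedAddCommGroup E]

/-- The set of projections of the point `p` on the set `B`. -/
def metricProj (p : E) (B : Set E) : Set E :=
  {q | q ∈ B ∧ dist p q = infDist p B}

/-- The metric pairs `(p, q)` of two sets: `p ∈ A`, `q ∈ B`, and `p` is a projection of `q` on `A`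
or `q` is a projection of `p` on `B`. -/
def metricPairs (A B : Set E) : Set (E × E) :=
  {z | z.1 ∈ A ∧ z.2 ∈ B ∧ (z.1 ∈ metricProj z.2 A ∨ z.2 ∈ metricProj z.1 B)}

/-- `(y 0, …, y (m - 1))` is a metric chain of the `m` sets `A 0, …, A (m - 1)`
(the values of `A` and `y` at indices `≥ m` are irrelevant). -/
def IsMetricChain (m : ℕ) (A : ℕ → Set E) (y : ℕ → E) : Prop :=
  (∀ i < m, y i ∈ A i) ∧ ∀ i, i + 1 < m → (y i, y (i + 1)) ∈ metricPairs (A i) (A (i + 1))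

/-- A partition `a = pt 0 < pt 1 < ⋯ < pt n = b` of the interval `[a, b]`
(the values of `pt` at indices `> n` are irrelevant). -/
structure IntervalPartition (a b : ℝ) where
  n : ℕ
  pt : ℕ → ℝ
  pt_zero : pt 0 = a
  pt_last : pt n = b
  pt_lt : ∀ i < n, pt i < pt (i + 1)

/-- The norm of a partition: the maximal length of its subintervals. -/
def IntervalPartition.mesh {a b : ℝ} (χ : IntervalPartition a b) : ℝ :=
  ⨆ i : Fin χ.n, (χ.pt (i + 1) - χ.pt i)

/-- The weighted metric Riemann sum of the multifunction `F` with the weight `κ`, for the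
partition `χ`; only the left endpoints of the subintervals occur. -/
def metricRiemannSum [NormedSpace ℝ E] {a b : ℝ} (χ : IntervalPartition a b) (κ : ℝ → ℝ)
    (F : ℝ → NonemptyCompacts E) : Set E :=
  {v | ∃ y : ℕ → E, IsMetricChain χ.n (fun i => (F (χ.pt i) : Set E)) y ∧
    v = ∑ i ∈ Finset.range χ.n, ((χ.pt (i + 1) - χ.pt i) * κ (χ.pt i)) • y i}

/-- The weighted metric integral of `F` over `[a, b]` with the weight `κ`: the upper Kuratowski
limit of the weighted metric Riemann sums as the norm of the partition tends to zero, that is, the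
set of all limits of sequences `v k` taken from Riemann sums whose partitions have norms tending
to zero. -/
def weightedMetricIntegral [NormedSpace ℝ E] (a b : ℝ) (κ : ℝ → ℝ)
    (F : ℝ → NonemptyCompacts E) : Set E :=
  {w | ∃ (χ : ℕ → IntervalPartition a b) (v : ℕ → E),
    Tendsto (fun k => (χ k).mesh) atTop (𝓝 0) ∧
    (∀ k, v k ∈ metricRiemannSum (χ k) κ F) ∧
    Tendsto v atTop (𝓝 w)}

/-- The class of set-valued functions of bounded variation on `[a, b]` (with respect to the
Hausdorff metric, which is the metric of `NonemptyCompacts E`) whose graph over `[a, b]` is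
compact. Values of `F` outside `[a, b]` are irrelevant. -/
def IsBVCompactGraph (a b : ℝ) (F : ℝ → NonemptyCompacts E) : Prop :=
  BoundedVariationOn F (Icc a b) ∧ IsCompact {p : ℝ × E | p.1 ∈ Icc a b ∧ p.2 ∈ F p.1}

/-- `f`, as a function on `[a, b]`, is locally Lipschitz around the point `x`. -/
def LocallyLipschitzAround {X : Type*} [MetricSpace X] (a b : ℝ) (f : ℝ → X) (x : ℝ) : Prop :=
  ∃ L > (0 : ℝ), ∃ δ > (0 : ℝ),
    ∀ x₁ ∈ Ioo (x - δ / 2) (x + δ / 2) ∩ Icc a b, ∀ x₂ ∈ Ioo (x - δ / 2) (x + δ / 2) ∩ Icc a b,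
      dist (f x₁) (f x₂) ≤ L * |x₁ - x₂|

/-- The kernel of the `n`-th Bernstein–Durrmeyer operator. -/
def durrmeyerKernel (n : ℕ) (x t : ℝ) : ℝ :=
  (n + 1) * ∑ k ∈ Finset.range (n + 1),
    (bernsteinPolynomial ℝ n k).eval x * (bernsteinPolynomial ℝ n k).eval t

/-- The kernel of the `n`-th Kantorovich operator. -/
def kantorovichKernel (n : ℕ) (x t : ℝ) : ℝ :=
  (n + 1) * ∑ k ∈ Finset.range (n + 1),
    (bernsteinPolynomial ℝ n k).eval x *
      (Icc ((k : ℝ) / (n + 1)) (((k : ℝ) + 1) / (n + 1))).indicator (fun _ => (1 : ℝ)) t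

/-- The set-valued Bernstein–Durrmeyer operator on `[0, 1]`: the value `M_n F (x)`. -/
def durrmeyerOp [NormedSpace ℝ E] (n : ℕ) (F : ℝ → NonemptyCompacts E) (x : ℝ) : Set E :=
  weightedMetricIntegral 0 1 (durrmeyerKernel n x) F

/-- The set-valued Kantorovich operator on `[0, 1]`: the value `K_n F (x)`. -/
def kantorovichOp [NormedSpace ℝ E] (n : ℕ) (F : ℝ → NonemptyCompacts E) (x : ℝ) : Set E :=
  weightedMetricIntegral 0 1 (kantorovichKernel n x) F

end MetricApprox

end

/-! Both kernels, as functions of `t`, are mixtures of probability densities with the Bernstein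
weights at `x`. The `k`-th density has second moment at most `1 / n` about `k / n`, and the weights
have variance `x (1 - x) / n` about `x`. So the kernel has mass one and its first absolute moment
about `x` is at most `3 / √n`.

The rest holds for any nonnegative, bounded, a.e. continuous weight of mass one. A link of a metric
chain is no longer than the Hausdorff distance of the two consecutive sets, so near `x` chains
inherit the Lipschitz constant `L`. Away from `x` the bound `R` on the values of `F` suffices.
Together these give `dist (y i) (y j) ≤ C (|t i - x| + |t j - x|)` with `C = L + 4 R / δ`
(`dist_metricChain_le`). With `t j` next to `x`, the Riemann sum is close to `y j`, which is close
to `F x`. In the limit the error is `C` times the first absolute moment. For the converse, a chain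
is run through a projection of a given point of `F x`, and compactness supplies a limit point
(`weightedMetricIntegral_approx`). -/

noncomputable section

open MeasureTheory

namespace MetricApprox

/-! ### Partitions and left Riemann sums. -/

namespace IntervalPartition

variable {a b : ℝ} (χ : IntervalPartition a b)

lemma pt_le_pt {i j : ℕ} (hij : i ≤ j) (hj : j ≤ χ.n) : χ.pt i ≤ χ.pt j := by
  induction j, hij using Nat.le_induction with
  | base => exact le_rfl
  | succ j _ ih => exact (ih (by omega)).trans (χ.pt_lt j (by omega)).le

lemma pt_mem_Icc {i : ℕ} (hi : i ≤ χ.n) : χ.pt i ∈ Icc a b := by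
  have h₀ := χ.pt_le_pt (Nat.zero_le i) hi
  have h₁ := χ.pt_le_pt hi le_rfl
  rw [χ.pt_zero] at h₀
  rw [χ.pt_last] at h₁
  exact ⟨h₀, h₁⟩

lemma sub_le_mesh {i : ℕ} (hi : i < χ.n) : χ.pt (i + 1) - χ.pt i ≤ χ.mesh :=
  le_ciSup (f := fun i : Fin χ.n => χ.pt (i + 1) - χ.pt i) (Set.finite_range _).bddAbove ⟨i, hi⟩

lemma mesh_nonneg : 0 ≤ χ.mesh :=
  Real.iSup_nonneg fun i => sub_nonneg.2 (χ.pt_lt i i.2).le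

lemma exists_mem_Icc {t : ℝ} (ht : t ∈ Icc a b) (hab : a < b) :
    ∃ i < χ.n, t ∈ Icc (χ.pt i) (χ.pt (i + 1)) ∧ (t < b → t < χ.pt (i + 1)) := by
  have hn : 0 < χ.n := by
    by_contra h
    have h₀ := χ.pt_last
    rw [Nat.eq_zero_of_not_pos h, χ.pt_zero] at h₀
    exact hab.ne h₀
  classical
  -- The cap `χ.n - 1` makes `i` index a genuine cell, so `t = b` falls into the last one.
  let i := Nat.findGreatest (fun i => χ.pt i ≤ t) (χ.n - 1)
  have hi : i ≤ χ.n - 1 := Nat.findGreatest_le _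
  have hle : χ.pt i ≤ t :=
    Nat.findGreatest_spec (P := fun i => χ.pt i ≤ t) (Nat.zero_le _) (by simpa [χ.pt_zero] using ht.1)
  have hlt : t < b → t < χ.pt (i + 1) := by
    intro htb
    by_contra! h
    rcases Nat.lt_or_ge (χ.n - 1) (i + 1) with h' | h'
    · have : i + 1 = χ.n := by omega
      rw [this, χ.pt_last] at h
      exact htb.not_ge h
    · have := Nat.le_findGreatest (P := fun i => χ.pt i ≤ t) h' h
      change i + 1 ≤ i at this
      omega
  refine ⟨i, by omega, ⟨hle, ?_⟩, hlt⟩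
  rcases ht.2.lt_or_eq with h | h
  · exact (hlt h).le
  · by_contra! h'
    have h₁ := χ.pt_le_pt (i := i + 1) (j := χ.n) (by omega) le_rfl
    rcases Nat.lt_or_ge (χ.n - 1) (i + 1) with h₂ | h₂
    · have : i + 1 = χ.n := by omega
      rw [this, χ.pt_last] at h'
      exact h'.ne' h
    · have := Nat.le_findGreatest (P := fun i => χ.pt i ≤ t) h₂ h'.le
      change i + 1 ≤ i at this
      omega

/-- The step function that takes the value `f (pt i)` on `[pt i, pt (i + 1))`. -/
def leftStep (f : ℝ → ℝ) (t : ℝ) : ℝ :=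
  ∑ i ∈ Finset.range χ.n, (Ico (χ.pt i) (χ.pt (i + 1))).indicator (fun _ => f (χ.pt i)) t

/-- The Riemann sum of `f` with left endpoints as tags. -/
def leftSum (f : ℝ → ℝ) : ℝ :=
  ∑ i ∈ Finset.range χ.n, (χ.pt (i + 1) - χ.pt i) * f (χ.pt i)

lemma leftStep_eq (f : ℝ → ℝ) {i : ℕ} (hi : i < χ.n) {t : ℝ}
    (ht : t ∈ Ico (χ.pt i) (χ.pt (i + 1))) : χ.leftStep f t = f (χ.pt i) := by
  rw [leftStep, Finset.sum_eq_single i, indicator_of_mem ht]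
  · intro j hj hji
    refine indicator_of_notMem (fun htj => ?_) _
    have hj' := Finset.mem_range.1 hj
    rcases lt_or_gt_of_ne hji with h | h
    · exact absurd (χ.pt_le_pt (Nat.succ_le_of_lt h) hi.le) (not_le.2 (ht.1.trans_lt htj.2))
    · exact absurd (χ.pt_le_pt (Nat.succ_le_of_lt h) hj'.le) (not_le.2 (htj.1.trans_lt ht.2))
  · intro h
    exact absurd (Finset.mem_range.2 hi) h

lemma measurable_leftStep (f : ℝ → ℝ) : Measurable (χ.leftStep f) :=
  Finset.measurable_sum _ fun _ _ => measurable_const.indicator measurableSet_Ico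

lemma setIntegral_leftStep (f : ℝ → ℝ) :
    ∫ t in Ico a b, χ.leftStep f t = χ.leftSum f := by
  simp only [leftStep, leftSum]
  rw [integral_finsetSum]
  · refine Finset.sum_congr rfl fun i hi => ?_
    have hi' := Finset.mem_range.1 hi
    rw [setIntegral_indicator measurableSet_Ico, setIntegral_const,
      inter_eq_self_of_subset_right]
    · simp [(χ.pt_lt i hi').le]
    · exact Ico_subset_Ico (χ.pt_mem_Icc hi'.le).1 (χ.pt_mem_Icc hi').2
  · intro i _
    refine IntegrableOn.integrable ?_
    exact (integrableOn_const (by simp)).indicator measurableSet_Ico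

/-- Left Riemann sums of a bounded function that is continuous almost everywhere converge to
the integral as the mesh of the partition tends to zero. -/
lemma tendsto_leftSum (hab : a < b) {f : ℝ → ℝ} {M : ℝ} (hM : ∀ t ∈ Icc a b, |f t| ≤ M)
    (hf : ∀ᵐ t, ContinuousAt f t) {χ : ℕ → IntervalPartition a b}
    (hχ : Tendsto (fun k => (χ k).mesh) atTop (𝓝 0)) :
    Tendsto (fun k => (χ k).leftSum f) atTop (𝓝 (∫ t in a..b, f t)) := by
  -- The step function samples `f` within one mesh of `t`; this yields both the domination by `M`
  -- and convergence at continuity points.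
  have key : ∀ k, ∀ t ∈ Ico a b, ∃ s ∈ Icc a b, |s - t| ≤ (χ k).mesh ∧
      (χ k).leftStep f t = f s := by
    intro k t ht
    obtain ⟨i, hi, hti, hlt⟩ := (χ k).exists_mem_Icc (Ico_subset_Icc_self ht) hab
    refine ⟨(χ k).pt i, (χ k).pt_mem_Icc hi.le, ?_, (χ k).leftStep_eq f hi ⟨hti.1, hlt ht.2⟩⟩
    have := (χ k).sub_le_mesh hi
    rw [abs_le]
    constructor <;> linarith [hti.1, hti.2, (χ k).mesh_nonneg]
  rw [intervalIntegral.integral_of_le hab.le, ← integral_Ico_eq_integral_Ioc]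
  simp only [← setIntegral_leftStep]
  refine tendsto_integral_of_dominated_convergence (fun _ => M)
    (fun k => ((χ k).measurable_leftStep f).aestronglyMeasurable) (integrable_const M) ?_ ?_
  · intro k
    refine (ae_restrict_iff' measurableSet_Ico).2 (Eventually.of_forall fun t ht => ?_)
    obtain ⟨s, hs, -, h⟩ := key k t ht
    rw [h]
    exact hM s hs
  · refine (ae_restrict_iff' measurableSet_Ico).2 (hf.mono fun t htf ht => ?_)
    choose s _ hst hs using fun k => key k t ht
    simp only [hs]
    refine htf.tendsto.comp ?_
    rw [tendsto_iff_dist_tendsto_zero]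
    exact squeeze_zero (fun _ => dist_nonneg) hst hχ

/-- The partition of `[a, b]` into `n + 1` subintervals of equal lengths. -/
def uniform (hab : a < b) (n : ℕ) : IntervalPartition a b where
  n := n + 1
  pt i := a + i * ((b - a) / (n + 1))
  pt_zero := by simp
  pt_last := by push_cast; field_simp; ring
  pt_lt i _ := by
    have : 0 < (b - a) / (n + 1) := div_pos (sub_pos.2 hab) (by positivity)
    push_cast
    nlinarith

lemma mesh_uniform_le (hab : a < b) (n : ℕ) : (uniform hab n).mesh ≤ (b - a) / (n + 1) := by
  refine Real.iSup_le (fun i => ?_) (div_nonneg (sub_nonneg.2 hab.le) (by positivity))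
  simp only [uniform]
  push_cast
  linarith

lemma tendsto_mesh_uniform (hab : a < b) :
    Tendsto (fun n => (uniform hab n).mesh) atTop (𝓝 0) := by
  refine squeeze_zero (fun n => mesh_nonneg _) (mesh_uniform_le hab) ?_
  have := (tendsto_one_div_add_atTop_nhds_zero_nat (𝕜 := ℝ)).const_mul (b - a)
  simpa [div_eq_mul_inv] using this

end IntervalPartition

/-! ### Metric chains and their Lipschitz-type bounds. -/

section MetricChain

variable {E : Type*} [NormedAddCommGroup E]

lemma infDist_le_dist {A B : NonemptyCompacts E} {p : E} (hp : p ∈ A) :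
    infDist p (B : Set E) ≤ dist A B :=
  infDist_le_hausdorffDist_of_mem hp <| hausdorffEDist_ne_top_of_nonempty_of_bounded A.nonempty
    B.nonempty A.isCompact.isBounded B.isCompact.isBounded

lemma exists_mem_metricProj (p : E) (B : NonemptyCompacts E) : ∃ q, q ∈ metricProj p B := by
  obtain ⟨q, hq, h⟩ := B.isCompact.exists_infDist_eq_dist B.nonempty p
  exact ⟨q, hq, h.symm⟩

lemma dist_le_of_mem_metricPairs {A B : NonemptyCompacts E} {p q : E}
    (h : (p, q) ∈ metricPairs (A : Set E) B) : dist p q ≤ dist A B := by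
  obtain ⟨hp, hq, h | h⟩ := h
  · rw [dist_comm p q, dist_comm A B, h.2]
    exact infDist_le_dist hq
  · rw [h.2]
    exact infDist_le_dist hp

/-- Through every point of one of the sets passes a metric chain. -/
lemma exists_metricChain (A : ℕ → NonemptyCompacts E) (j : ℕ) {p : E} (hp : p ∈ A j) :
    ∃ y : ℕ → E, y j = p ∧ ∀ m, IsMetricChain m (fun i => (A i : Set E)) y := by
  suffices H : ∃ y : ℕ → E, y j = p ∧ (∀ i, y i ∈ (A i : Set E)) ∧
      ∀ i, (y i, y (i + 1)) ∈ metricPairs (A i : Set E) (A (i + 1)) by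
    obtain ⟨y, hy, h₁, h₂⟩ := H
    exact ⟨y, hy, fun m => ⟨fun i _ => h₁ i, fun i _ => h₂ i⟩⟩
  choose proj hproj using exists_mem_metricProj (E := E)
  -- From index 0, project forward forever. For `j + 1`, shift the family and prepend a projection
  -- onto `A 0`.
  induction j generalizing A with
  | zero =>
    let y : ℕ → E := Nat.rec p fun i q => proj q (A (i + 1))
    have hy : ∀ i, y i ∈ (A i : Set E) := fun i => by
      cases i with
      | zero => exact hp
      | succ i => exact (hproj (y i) (A (i + 1))).1
    exact ⟨y, rfl, hy, fun i => ⟨hy i, hy (i + 1), Or.inr (hproj (y i) (A (i + 1)))⟩⟩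
  | succ j ih =>
    obtain ⟨y, hyj, h₁, h₂⟩ := ih (fun i => A (i + 1)) hp
    let z : ℕ → E := fun i => Nat.casesOn i (proj (y 0) (A 0)) y
    have hz : ∀ i, z i ∈ (A i : Set E) := fun i => by
      cases i with
      | zero => exact (hproj (y 0) (A 0)).1
      | succ i => exact h₁ i
    refine ⟨z, hyj, hz, fun i => ?_⟩
    cases i with
    | zero => exact ⟨hz 0, hz 1, Or.inl (hproj (y 0) (A 0))⟩
    | succ i => exact h₂ i

variable {a b x L δ R : ℝ} {F : ℝ → NonemptyCompacts E}

/-- If both nodes are within `δ / 2` of `x`, so are all nodes between them, and the link bounds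
telescope. Otherwise the right-hand sum is at least `δ / 2`, which absorbs the trivial bound `2 R`.
This is why distances to `x` appear rather than the distance between the nodes. -/
lemma dist_metricChain_le (hL : 0 ≤ L) (hδ : 0 < δ) (hR : ∀ t ∈ Icc a b, ∀ p ∈ F t, ‖p‖ ≤ R)
    (hF : ∀ x₁ ∈ Ioo (x - δ / 2) (x + δ / 2) ∩ Icc a b,
      ∀ x₂ ∈ Ioo (x - δ / 2) (x + δ / 2) ∩ Icc a b, dist (F x₁) (F x₂) ≤ L * |x₁ - x₂|)
    (χ : IntervalPartition a b) {y : ℕ → E}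
    (hy : IsMetricChain χ.n (fun i => (F (χ.pt i) : Set E)) y) {i j : ℕ} (hi : i < χ.n)
    (hj : j < χ.n) :
    dist (y i) (y j) ≤ (L + 4 * R / δ) * (|χ.pt i - x| + |χ.pt j - x|) := by
  wlog hij : i ≤ j generalizing i j
  · rw [dist_comm, add_comm |_|]
    exact this hj hi (le_of_not_ge hij)
  have hi' := hR _ (χ.pt_mem_Icc hi.le) _ (hy.1 i hi)
  have hj' := hR _ (χ.pt_mem_Icc hj.le) _ (hy.1 j hj)
  have hR0 : 0 ≤ R := (norm_nonneg _).trans hi'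
  have hC : 0 ≤ 4 * R / δ := by positivity
  by_cases h : |χ.pt i - x| < δ / 2 ∧ |χ.pt j - x| < δ / 2
  · rw [abs_lt, abs_lt] at h
    have hmem : ∀ k, i ≤ k → k ≤ j → χ.pt k ∈ Ioo (x - δ / 2) (x + δ / 2) ∩ Icc a b := by
      intro k hik hkj
      have h₁ := χ.pt_le_pt hik (hkj.trans hj.le)
      have h₂ := χ.pt_le_pt hkj hj.le
      exact ⟨⟨by linarith, by linarith⟩, χ.pt_mem_Icc (hkj.trans hj.le)⟩
    have h₁ : dist (y i) (y j) ≤ ∑ k ∈ Finset.Ico i j, L * (χ.pt (k + 1) - χ.pt k) := by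
      refine dist_le_Ico_sum_of_dist_le hij fun {k} hik hkj => ?_
      refine (dist_le_of_mem_metricPairs (hy.2 k (by omega))).trans ?_
      refine (hF _ (hmem k hik hkj.le) _ (hmem (k + 1) (by omega) hkj)).trans_eq ?_
      rw [abs_sub_comm, abs_of_pos (sub_pos.2 (χ.pt_lt k (by omega)))]
    rw [← Finset.mul_sum, Finset.sum_Ico_sub _ hij] at h₁
    have h₂ : χ.pt j - χ.pt i ≤ |χ.pt i - x| + |χ.pt j - x| := by
      linarith [neg_abs_le (χ.pt i - x), le_abs_self (χ.pt j - x)]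
    calc dist (y i) (y j) ≤ L * (|χ.pt i - x| + |χ.pt j - x|) := h₁.trans (by gcongr)
      _ ≤ _ := by gcongr; linarith
  · have h₁ : δ / 2 ≤ |χ.pt i - x| + |χ.pt j - x| := by
      by_contra! h'
      exact h ⟨by linarith [abs_nonneg (χ.pt j - x)], by linarith [abs_nonneg (χ.pt i - x)]⟩
    calc dist (y i) (y j) ≤ 2 * R := by linarith [dist_le_norm_add_norm (y i) (y j)]
      _ = 4 * R / δ * (δ / 2) := by field_simp; ring
      _ ≤ (L + 4 * R / δ) * (|χ.pt i - x| + |χ.pt j - x|) := by gcongr; linarith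

lemma dist_le_of_locallyLipschitz (hL : 0 ≤ L) (hδ : 0 < δ)
    (hR : ∀ t ∈ Icc a b, ∀ p ∈ F t, ‖p‖ ≤ R)
    (hF : ∀ x₁ ∈ Ioo (x - δ / 2) (x + δ / 2) ∩ Icc a b,
      ∀ x₂ ∈ Ioo (x - δ / 2) (x + δ / 2) ∩ Icc a b, dist (F x₁) (F x₂) ≤ L * |x₁ - x₂|)
    (hx : x ∈ Icc a b) {t : ℝ} (ht : t ∈ Icc a b) :
    dist (F t) (F x) ≤ (L + 4 * R / δ) * |t - x| := by
  obtain ⟨p₀, hp₀⟩ := (F t).nonempty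
  obtain ⟨q₀, hq₀⟩ := (F x).nonempty
  have hR0 : 0 ≤ R := (norm_nonneg _).trans (hR t ht p₀ hp₀)
  have hC : 0 ≤ 4 * R / δ := by positivity
  by_cases h : |t - x| < δ / 2
  · have h' := abs_lt.1 h
    refine (hF t ⟨⟨by linarith, by linarith⟩, ht⟩ x ⟨⟨by linarith, by linarith⟩, hx⟩).trans ?_
    gcongr
    linarith
  · calc dist (F t) (F x) ≤ 2 * R := by
          refine hausdorffDist_le_of_mem_dist (by linarith) (fun p hp => ⟨q₀, hq₀, ?_⟩)
            (fun q hq => ⟨p₀, hp₀, ?_⟩)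
          · linarith [dist_le_norm_add_norm p q₀, hR t ht p hp, hR x hx q₀ hq₀]
          · linarith [dist_le_norm_add_norm q p₀, hR t ht p₀ hp₀, hR x hx q hq]
      _ = 4 * R / δ * (δ / 2) := by field_simp; ring
      _ ≤ (L + 4 * R / δ) * |t - x| := by gcongr <;> linarith

end MetricChain

/-! ### Approximation for a general weight of mass one. -/

section WeightedMetricIntegral

variable {E : Type*} [NormedAddCommGroup E] [NormedSpace ℝ E] {a b x C R : ℝ} {κ : ℝ → ℝ}
  {F : ℝ → NonemptyCompacts E}

/-- The `ε`-form makes closedness immediate, with no diagonal sequence. -/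
lemma mem_weightedMetricIntegral_iff {w : E} :
    w ∈ weightedMetricIntegral a b κ F ↔
      ∀ ε > 0, ∃ χ : IntervalPartition a b, χ.mesh < ε ∧
        ∃ v ∈ metricRiemannSum χ κ F, dist v w < ε := by
  constructor
  · rintro ⟨χ, v, hχ, hv, hvw⟩ ε hε
    obtain ⟨k, h₁, h₂⟩ :=
      ((hχ.eventually (gt_mem_nhds hε)).and (hvw.eventually (ball_mem_nhds w hε))).exists
    exact ⟨χ k, h₁, v k, hv k, h₂⟩
  · intro h
    choose χ hχ v hv hvw using fun k : ℕ => h (1 / (k + 1)) (by positivity)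
    exact ⟨χ, v, squeeze_zero (fun k => (χ k).mesh_nonneg) (fun k => (hχ k).le)
        tendsto_one_div_add_atTop_nhds_zero_nat, hv,
      tendsto_iff_dist_tendsto_zero.2 <| squeeze_zero (fun _ => dist_nonneg)
        (fun k => (hvw k).le) tendsto_one_div_add_atTop_nhds_zero_nat⟩

lemma isClosed_weightedMetricIntegral : IsClosed (weightedMetricIntegral a b κ F) := by
  refine isClosed_of_closure_subset fun w hw => mem_weightedMetricIntegral_iff.2 fun ε hε => ?_
  obtain ⟨w', hw', hd⟩ := Metric.mem_closure_iff.1 hw (ε / 2) (half_pos hε)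
  obtain ⟨χ, hχ, v, hv, hvw⟩ := mem_weightedMetricIntegral_iff.1 hw' (ε / 2) (half_pos hε)
  refine ⟨χ, hχ.trans (half_lt_self hε), v, hv, ?_⟩
  rw [dist_comm] at hd
  linarith [dist_triangle v w' w]

/-- A bound for the distance of the point `∑ i, (t (i + 1) - t i) κ(t i) y i` of a metric Riemann
sum from a value `y j` with `t j` near `x`. -/
def chainError (C R x : ℝ) (κ : ℝ → ℝ) (χ : IntervalPartition a b) : ℝ :=
  C * (χ.leftSum (fun t => κ t * |t - x|) + χ.mesh * χ.leftSum κ) + R * |χ.leftSum κ - 1|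

lemma dist_sum_smul_le_chainError (hC : 0 ≤ C) (hκ : ∀ t ∈ Icc a b, 0 ≤ κ t)
    (χ : IntervalPartition a b) {y : ℕ → E} {j : ℕ} (hyR : ‖y j‖ ≤ R)
    (hy : ∀ i < χ.n, dist (y i) (y j) ≤ C * (|χ.pt i - x| + |χ.pt j - x|))
    (hjx : |χ.pt j - x| ≤ χ.mesh) :
    dist (∑ i ∈ Finset.range χ.n, ((χ.pt (i + 1) - χ.pt i) * κ (χ.pt i)) • y i) (y j) ≤
      chainError C R x κ χ := by
  -- The weights of a finite partition need not sum to one; the defect multiplies `y j` and is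
  -- controlled by `R`.
  have hsplit : (∑ i ∈ Finset.range χ.n, ((χ.pt (i + 1) - χ.pt i) * κ (χ.pt i)) • y i) - y j =
      (∑ i ∈ Finset.range χ.n, ((χ.pt (i + 1) - χ.pt i) * κ (χ.pt i)) • (y i - y j)) +
        (χ.leftSum κ - 1) • y j := by
    simp only [smul_sub, Finset.sum_sub_distrib, ← Finset.sum_smul, IntervalPartition.leftSum,
      sub_smul (_ : ℝ) 1 (y j), one_smul]
    abel
  have hterm : ‖∑ i ∈ Finset.range χ.n, ((χ.pt (i + 1) - χ.pt i) * κ (χ.pt i)) • (y i - y j)‖ ≤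
      C * (χ.leftSum (fun t => κ t * |t - x|) + χ.mesh * χ.leftSum κ) := by
    refine (norm_sum_le _ _).trans ?_
    rw [IntervalPartition.leftSum, IntervalPartition.leftSum, Finset.mul_sum,
      ← Finset.sum_add_distrib, Finset.mul_sum]
    refine Finset.sum_le_sum fun i hi => ?_
    have hi' := Finset.mem_range.1 hi
    have h₀ : 0 ≤ (χ.pt (i + 1) - χ.pt i) * κ (χ.pt i) :=
      mul_nonneg (sub_nonneg.2 (χ.pt_lt i hi').le) (hκ _ (χ.pt_mem_Icc hi'.le))
    rw [norm_smul, Real.norm_of_nonneg h₀, ← dist_eq_norm]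
    calc _ ≤ ((χ.pt (i + 1) - χ.pt i) * κ (χ.pt i)) * (C * (|χ.pt i - x| + χ.mesh)) :=
          mul_le_mul_of_nonneg_left ((hy i hi').trans (by gcongr)) h₀
      _ = _ := by ring
  rw [dist_eq_norm, hsplit, chainError]
  refine (norm_add_le _ _).trans (add_le_add hterm ?_)
  rw [norm_smul, Real.norm_eq_abs, mul_comm]
  gcongr

/-- The mesh and mass-defect terms vanish in the limit. The extra `C * mesh` pays for passing
between `F (t j)` and `F x`. -/
lemma tendsto_chainError (hab : a < b) {M : ℝ} (hM : ∀ t ∈ Icc a b, |κ t| ≤ M)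
    (hκc : ∀ᵐ t, ContinuousAt κ t) (hκ1 : ∫ t in a..b, κ t = 1) (hx : x ∈ Icc a b)
    {χ : ℕ → IntervalPartition a b} (hχ : Tendsto (fun k => (χ k).mesh) atTop (𝓝 0)) :
    Tendsto (fun k => chainError C R x κ (χ k) + C * (χ k).mesh) atTop
      (𝓝 (C * ∫ t in a..b, κ t * |t - x|)) := by
  have h₁ := IntervalPartition.tendsto_leftSum hab hM hκc hχ
  have h₂ : Tendsto (fun k => (χ k).leftSum fun t => κ t * |t - x|) atTop
      (𝓝 (∫ t in a..b, κ t * |t - x|)) := by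
    refine IntervalPartition.tendsto_leftSum hab (M := M * (b - a)) (fun t ht => ?_) ?_ hχ
    · rw [abs_mul, abs_abs]
      have : |t - x| ≤ b - a := abs_le.2 ⟨by linarith [ht.1, hx.2], by linarith [ht.2, hx.1]⟩
      exact mul_le_mul (hM t ht) this (abs_nonneg _) ((abs_nonneg _).trans (hM t ht))
    · filter_upwards [hκc] with t ht
      exact ht.mul (by fun_prop)
  rw [hκ1] at h₁
  have h₃ := (((h₂.add (hχ.mul h₁)).const_mul C).add
    (((h₁.sub_const 1).abs).const_mul R)).add (hχ.const_mul C)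
  simpa [chainError] using h₃

/-- If the total mass of the nonnegative weight `κ` is one, then the weighted metric integral of
`F` differs from `F x` by at most a multiple of the first absolute moment of `κ` about `x`. -/
theorem weightedMetricIntegral_approx [ProperSpace E] (hab : a < b) (hx : x ∈ Icc a b)
    (hC : 0 ≤ C) (hR : ∀ t ∈ Icc a b, ∀ p ∈ F t, ‖p‖ ≤ R)
    (hFx : ∀ t ∈ Icc a b, dist (F t) (F x) ≤ C * |t - x|)
    (hchain : ∀ (χ : IntervalPartition a b) (y : ℕ → E),
      IsMetricChain χ.n (fun i => (F (χ.pt i) : Set E)) y → ∀ i < χ.n, ∀ j < χ.n,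
        dist (y i) (y j) ≤ C * (|χ.pt i - x| + |χ.pt j - x|))
    {M : ℝ} (hM : ∀ t ∈ Icc a b, |κ t| ≤ M) (hκ : ∀ t ∈ Icc a b, 0 ≤ κ t)
    (hκc : ∀ᵐ t, ContinuousAt κ t) (hκ1 : ∫ t in a..b, κ t = 1) :
    (weightedMetricIntegral a b κ F).Nonempty ∧ IsCompact (weightedMetricIntegral a b κ F) ∧
      hausdorffDist (weightedMetricIntegral a b κ F) (F x) ≤
        C * ∫ t in a..b, κ t * |t - x| := by
  have hnear : ∀ χ : IntervalPartition a b, ∃ j < χ.n, |χ.pt j - x| ≤ χ.mesh := by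
    intro χ
    obtain ⟨j, hj, hxj, -⟩ := χ.exists_mem_Icc hx hab
    refine ⟨j, hj, abs_le.2 ⟨?_, ?_⟩⟩ <;>
      linarith [hxj.1, hxj.2, χ.sub_le_mesh hj, χ.mesh_nonneg]
  have hmoment : 0 ≤ C * ∫ t in a..b, κ t * |t - x| :=
    mul_nonneg hC <| intervalIntegral.integral_nonneg hab.le fun t ht =>
      mul_nonneg (hκ t ht) (abs_nonneg _)
  have hleft : ∀ w ∈ weightedMetricIntegral a b κ F,
      infDist w (F x) ≤ C * ∫ t in a..b, κ t * |t - x| := by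
    rintro w ⟨χ, v, hχ, hv, hvw⟩
    refine le_of_tendsto_of_tendsto ((continuous_infDist_pt _).tendsto w |>.comp hvw)
      (tendsto_chainError (R := R) hab hM hκc hκ1 hx hχ) (Eventually.of_forall fun k => ?_)
    obtain ⟨y, hy, hvy⟩ := hv k
    obtain ⟨j, hj, hjx⟩ := hnear (χ k)
    have hyj : y j ∈ F ((χ k).pt j) := hy.1 j hj
    have h₁ := dist_sum_smul_le_chainError hC hκ (χ k) (hR _ ((χ k).pt_mem_Icc hj.le) _ hyj)
      (fun i hi => hchain _ y hy i hi j hj) hjx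
    rw [← hvy] at h₁
    have h₂ : infDist (y j) (F x) ≤ C * (χ k).mesh :=
      (infDist_le_dist hyj).trans <| (hFx _ ((χ k).pt_mem_Icc hj.le)).trans (by gcongr)
    have h₃ := infDist_le_infDist_add_dist (s := (F x : Set E)) (x := v k) (y := y j)
    simp only [Function.comp_apply]
    linarith
  have hright : ∀ z ∈ F x, ∃ w ∈ weightedMetricIntegral a b κ F,
      dist z w ≤ C * ∫ t in a..b, κ t * |t - x| := by
    intro z hz
    have hex : ∀ χ : IntervalPartition a b, ∃ v ∈ metricRiemannSum χ κ F,
        dist v z ≤ chainError C R x κ χ + C * χ.mesh := by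
      intro χ
      obtain ⟨j, hj, hjx⟩ := hnear χ
      obtain ⟨q, hq, hzq⟩ := exists_mem_metricProj z (F (χ.pt j))
      obtain ⟨y, rfl, hy⟩ := exists_metricChain (fun i => F (χ.pt i)) j hq
      refine ⟨_, ⟨y, hy χ.n, rfl⟩, ?_⟩
      have h₁ := dist_sum_smul_le_chainError hC hκ χ (hR _ (χ.pt_mem_Icc hj.le) _ hq)
        (fun i hi => hchain _ y (hy χ.n) i hi j hj) hjx
      have h₂ : dist (y j) z ≤ C * χ.mesh := by
        rw [dist_comm, hzq]
        refine (infDist_le_dist hz).trans ?_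
        rw [dist_comm]
        exact (hFx _ (χ.pt_mem_Icc hj.le)).trans (by gcongr)
      exact (dist_triangle _ (y j) _).trans (add_le_add h₁ h₂)
    choose v hv hvz using fun k => hex (IntervalPartition.uniform hab k)
    have hχ := IntervalPartition.tendsto_mesh_uniform hab
    have hlim := tendsto_chainError (C := C) (R := R) hab hM hκc hκ1 hx hχ
    -- The convergent error bounds are bounded, so all `v k` lie in one closed ball about `z`, which
    -- is compact.
    obtain ⟨B, hB⟩ := hlim.bddAbove_range
    obtain ⟨w, -, φ, hφ, hw⟩ := (isCompact_closedBall z B).tendsto_subseq (x := v)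
      fun k => (hvz k).trans (hB ⟨k, rfl⟩)
    refine ⟨w, ⟨_, _, hχ.comp hφ.tendsto_atTop, fun k => hv (φ k), hw⟩, ?_⟩
    rw [dist_comm]
    exact le_of_tendsto_of_tendsto (hw.dist tendsto_const_nhds) (hlim.comp hφ.tendsto_atTop)
      (Eventually.of_forall fun k => hvz (φ k))
  refine ⟨?_, ?_, ?_⟩
  · obtain ⟨z, hz⟩ := (F x).nonempty
    obtain ⟨w, hw, -⟩ := hright z hz
    exact ⟨w, hw⟩
  · refine ((F x).isCompact.cthickening
      (r := C * ∫ t in a..b, κ t * |t - x|)).of_isClosed_subset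
        isClosed_weightedMetricIntegral fun w hw => ?_
    obtain ⟨q, hq, h⟩ := (F x).isCompact.exists_infDist_eq_dist (F x).nonempty w
    exact mem_cthickening_of_dist_le w q _ _ hq (h ▸ hleft w hw)
  · refine hausdorffDist_le_of_infDist hmoment hleft fun z hz => ?_
    obtain ⟨w, hw, hzw⟩ := hright z hz
    exact (infDist_le_dist_of_mem hw).trans hzw

end WeightedMetricIntegral

/-! ### Moments of Bernstein polynomials. -/

section Bernstein

lemma bernsteinPolynomial_eval_nonneg (n k : ℕ) {t : ℝ} (ht : t ∈ Icc (0 : ℝ) 1) :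
    0 ≤ (bernsteinPolynomial ℝ n k).eval t := by
  have h₀ := ht.1
  have h₁ := sub_nonneg.2 ht.2
  simp only [bernsteinPolynomial, Polynomial.eval_mul, Polynomial.eval_natCast,
    Polynomial.eval_pow, Polynomial.eval_X, Polynomial.eval_sub, Polynomial.eval_one]
  positivity

lemma sum_bernsteinPolynomial_eval (n : ℕ) (t : ℝ) :
    ∑ k ∈ Finset.range (n + 1), (bernsteinPolynomial ℝ n k).eval t = 1 := by
  rw [← Polynomial.eval_finsetSum, bernsteinPolynomial.sum, Polynomial.eval_one]

lemma bernsteinPolynomial_eval_le_one (n k : ℕ) {t : ℝ} (ht : t ∈ Icc (0 : ℝ) 1) :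
    (bernsteinPolynomial ℝ n k).eval t ≤ 1 := by
  rcases Nat.lt_or_ge n k with h | h
  · simp [bernsteinPolynomial.eq_zero_of_lt ℝ h]
  · rw [← sum_bernsteinPolynomial_eval n t]
    exact Finset.single_le_sum (f := fun k => (bernsteinPolynomial ℝ n k).eval t)
      (fun j _ => bernsteinPolynomial_eval_nonneg n j ht) (Finset.mem_range_succ_iff.2 h)

lemma sum_bernsteinPolynomial_eval_mul_sq {n : ℕ} (hn : n ≠ 0) (x : ℝ) :
    ∑ k ∈ Finset.range (n + 1), (bernsteinPolynomial ℝ n k).eval x * ((k : ℝ) / n - x) ^ 2 =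
      x * (1 - x) / n := by
  have h := congr_arg (Polynomial.eval x) (bernsteinPolynomial.variance ℝ n)
  simp only [Polynomial.eval_finsetSum, Polynomial.eval_mul, Polynomial.eval_pow,
    Polynomial.eval_sub, nsmul_eq_mul, Polynomial.eval_natCast, Polynomial.eval_X,
    Polynomial.eval_one] at h
  have hn' : (n : ℝ) ≠ 0 := Nat.cast_ne_zero.2 hn
  calc _ = (∑ k ∈ Finset.range (n + 1),
        (n * x - k) ^ 2 * (bernsteinPolynomial ℝ n k).eval x) / (n : ℝ) ^ 2 := by
        rw [Finset.sum_div]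
        refine Finset.sum_congr rfl fun k _ => ?_
        field_simp
        ring
    _ = _ := by
        rw [h]
        field_simp

/-- The derivative of `p (n+1) (j+1)` is `(n+1) (p n j - p n (j+1))`. Integrating it shows that
neighbouring integrals agree for `j < n`, while `j = n` gives the value because `p n (n+1) = 0`. -/
lemma integral_bernsteinPolynomial {n k : ℕ} (hk : k ≤ n) :
    ∫ t in (0 : ℝ)..1, (bernsteinPolynomial ℝ n k).eval t = 1 / (n + 1) := by
  have hint : ∀ j, IntervalIntegrable (fun t => (bernsteinPolynomial ℝ n j).eval t) volume 0 1 :=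
    fun j => (Polynomial.continuous _).intervalIntegrable _ _
  have step : ∀ j, ((n : ℝ) + 1) * ((∫ t in (0 : ℝ)..1, (bernsteinPolynomial ℝ n j).eval t) -
      ∫ t in (0 : ℝ)..1, (bernsteinPolynomial ℝ n (j + 1)).eval t) = if j = n then 1 else 0 := by
    intro j
    have h := intervalIntegral.integral_eq_sub_of_hasDerivAt (a := (0 : ℝ)) (b := 1)
      (fun t _ => (bernsteinPolynomial ℝ (n + 1) (j + 1)).hasDerivAt t)
      ((Polynomial.continuous _).intervalIntegrable _ _)
    rw [bernsteinPolynomial.derivative_succ_aux, bernsteinPolynomial.eval_at_0,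
      bernsteinPolynomial.eval_at_1] at h
    rw [← intervalIntegral.integral_sub (hint j) (hint (j + 1)),
      ← intervalIntegral.integral_const_mul]
    simpa using h
  have hn : (n : ℝ) + 1 ≠ 0 := by positivity
  induction hk using Nat.decreasingInduction with
  | self =>
    have h := step n
    simp only [bernsteinPolynomial.eq_zero_of_lt ℝ (Nat.lt_succ_self n), Polynomial.eval_zero,
      intervalIntegral.integral_zero, sub_zero, if_true] at h
    rw [eq_div_iff hn, mul_comm, h]
  | of_succ k hk ih =>
    have h := step k
    rw [if_neg hk.ne, mul_eq_zero, or_iff_right hn, sub_eq_zero] at h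
    rw [h, ih]

/-- A factor `t` only raises both indices, so moments reduce to integrals of single Bernstein
polynomials. -/
lemma mul_bernsteinPolynomial_eval (n k : ℕ) (t : ℝ) :
    t * (bernsteinPolynomial ℝ n k).eval t =
      (k + 1) / (n + 1) * (bernsteinPolynomial ℝ (n + 1) (k + 1)).eval t := by
  have h : ((n : ℝ) + 1) * n.choose k = (n + 1).choose (k + 1) * (k + 1) := by
    exact_mod_cast Nat.add_one_mul_choose_eq n k
  simp only [bernsteinPolynomial, Polynomial.eval_mul, Polynomial.eval_natCast,
    Polynomial.eval_pow, Polynomial.eval_X, Polynomial.eval_sub, Polynomial.eval_one,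
    Nat.add_sub_add_right]
  rw [div_mul_eq_mul_div, eq_div_iff (by positivity)]
  linear_combination t ^ (k + 1) * (1 - t) ^ (n - k) * h

lemma integral_bernsteinPolynomial_mul_sq_le {n k : ℕ} (hn : n ≠ 0) (hk : k ≤ n) :
    ∫ t in (0 : ℝ)..1, ((n : ℝ) + 1) * (bernsteinPolynomial ℝ n k).eval t * (t - k / n) ^ 2 ≤
      1 / (n : ℝ) := by
  have hint : ∀ m j, IntervalIntegrable (fun t => (bernsteinPolynomial ℝ m j).eval t) volume 0 1 :=
    fun m j => (Polynomial.continuous _).intervalIntegrable _ _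
  have hexp : ∀ t : ℝ, ((n : ℝ) + 1) * (bernsteinPolynomial ℝ n k).eval t * (t - k / n) ^ 2 =
      (k + 1) * (k + 2) / (n + 2) * (bernsteinPolynomial ℝ (n + 2) (k + 2)).eval t -
      2 * (k / n) * (k + 1) * (bernsteinPolynomial ℝ (n + 1) (k + 1)).eval t +
      (n + 1) * (k / n) ^ 2 * (bernsteinPolynomial ℝ n k).eval t := by
    intro t
    have h₁ := mul_bernsteinPolynomial_eval n k t
    have h₂ := mul_bernsteinPolynomial_eval (n + 1) (k + 1) t
    rw [div_mul_eq_mul_div, eq_div_iff (by positivity)] at h₁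
    push_cast at h₂
    have e₁ : (n : ℝ) + 1 + 1 = n + 2 := by ring
    have e₂ : (k : ℝ) + 1 + 1 = k + 2 := by ring
    rw [e₁, e₂] at h₂
    rw [mul_div_assoc, mul_assoc ((k : ℝ) + 1), ← h₂]
    linear_combination (t - 2 * (k / n)) * h₁
  simp only [hexp]
  rw [intervalIntegral.integral_add, intervalIntegral.integral_sub,
    intervalIntegral.integral_const_mul, intervalIntegral.integral_const_mul,
    intervalIntegral.integral_const_mul, integral_bernsteinPolynomial hk,
    integral_bernsteinPolynomial (Nat.succ_le_succ hk),
    integral_bernsteinPolynomial (Nat.succ_le_succ (Nat.succ_le_succ hk))]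
  · have hn' : (0 : ℝ) < n := by positivity
    have hk' : (k : ℝ) ≤ n := by exact_mod_cast hk
    have hk0 : (0 : ℝ) ≤ k := by positivity
    have hval : ((k : ℝ) + 1) * (k + 2) / (n + 2) * (1 / ((n + 2 : ℕ) + 1)) -
        2 * (k / n) * (k + 1) * (1 / ((n + 1 : ℕ) + 1)) + (n + 1) * (k / n) ^ 2 * (1 / (n + 1)) =
        (n * (k * (n - k)) + 2 * n ^ 2 - 6 * (k * (n - k))) / (n ^ 2 * ((n + 2) * (n + 3))) := by
      push_cast
      have e₁ : (n : ℝ) + 1 + 1 = n + 2 := by ring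
      have e₂ : (n : ℝ) + 2 + 1 = n + 3 := by ring
      rw [e₁, e₂]
      field_simp
      ring
    rw [hval, div_le_div_iff₀ (by positivity) hn']
    have h₁ : 0 ≤ (k : ℝ) * (n - k) := mul_nonneg hk0 (sub_nonneg.2 hk')
    have h₂ : (k : ℝ) * (n - k) ≤ n ^ 2 := by nlinarith
    have h₃ : (n : ℝ) * (k * (n - k)) ≤ n * n ^ 2 := mul_le_mul_of_nonneg_left h₂ hn'.le
    have h₄ : (n : ℝ) * (k * (n - k)) + 2 * n ^ 2 - 6 * (k * (n - k)) ≤ n * n ^ 2 + 2 * n ^ 2 := by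
      linarith
    refine (mul_le_mul_of_nonneg_right h₄ hn'.le).trans ?_
    -- This is exactly `n² (n+2) (n+3) - (n³ + 2 n²) n`.
    have h₅ : (0 : ℝ) ≤ 3 * n ^ 3 + 6 * n ^ 2 := by positivity
    linear_combination h₅
  all_goals
    first
    | exact (hint _ _).const_mul _
    | exact ((hint _ _).const_mul _).sub ((hint _ _).const_mul _)

end Bernstein

/-! ### Mixtures with Bernstein weights. -/

section BernsteinMixture

/-- The mixture `∑ k, p n k (x) μ k` of the functions `μ k` with the Bernstein weights. -/
def bernsteinMixture (n : ℕ) (μ : ℕ → ℝ → ℝ) (x t : ℝ) : ℝ :=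
  ∑ k ∈ Finset.range (n + 1), (bernsteinPolynomial ℝ n k).eval x * μ k t

variable {n : ℕ} {μ : ℕ → ℝ → ℝ} {x : ℝ}

lemma bernsteinMixture_nonneg (hx : x ∈ Icc (0 : ℝ) 1) {t : ℝ} (hμ : ∀ k, 0 ≤ μ k t) :
    0 ≤ bernsteinMixture n μ x t :=
  Finset.sum_nonneg fun k _ => mul_nonneg (bernsteinPolynomial_eval_nonneg n k hx) (hμ k)

lemma bernsteinMixture_le (hx : x ∈ Icc (0 : ℝ) 1) {t M : ℝ} (hμ : ∀ k, μ k t ≤ M) :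
    bernsteinMixture n μ x t ≤ M := by
  calc bernsteinMixture n μ x t
      ≤ ∑ k ∈ Finset.range (n + 1), (bernsteinPolynomial ℝ n k).eval x * M :=
        Finset.sum_le_sum fun k _ =>
          mul_le_mul_of_nonneg_left (hμ k) (bernsteinPolynomial_eval_nonneg n k hx)
    _ = M := by rw [← Finset.sum_mul, sum_bernsteinPolynomial_eval, one_mul]

lemma ae_continuousAt_bernsteinMixture (hμ : ∀ k, ∀ᵐ t, ContinuousAt (μ k) t) :
    ∀ᵐ t, ContinuousAt (bernsteinMixture n μ x) t := by
  filter_upwards [ae_all_iff.2 hμ] with t ht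
  exact tendsto_finsetSum _ fun k _ => (ht k).const_mul _

lemma integral_bernsteinMixture_mul {g : ℝ → ℝ} (hg : Continuous g)
    (hμ : ∀ k, IntervalIntegrable (μ k) volume 0 1) :
    ∫ t in (0 : ℝ)..1, bernsteinMixture n μ x t * g t =
      ∑ k ∈ Finset.range (n + 1), (bernsteinPolynomial ℝ n k).eval x *
        ∫ t in (0 : ℝ)..1, μ k t * g t := by
  simp only [bernsteinMixture, Finset.sum_mul, mul_assoc]
  rw [intervalIntegral.integral_finsetSum]
  · simp only [intervalIntegral.integral_const_mul]
  · exact fun k _ => ((hμ k).mul_continuousOn hg.continuousOn).const_mul _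

lemma integral_bernsteinMixture (hμ : ∀ k, IntervalIntegrable (μ k) volume 0 1)
    (h1 : ∀ k ≤ n, ∫ t in (0 : ℝ)..1, μ k t = 1) :
    ∫ t in (0 : ℝ)..1, bernsteinMixture n μ x t = 1 := by
  have h := integral_bernsteinMixture_mul (n := n) (x := x) (g := fun _ => 1) continuous_const hμ
  simp only [mul_one] at h
  rw [h]
  refine Eq.trans ?_ (sum_bernsteinPolynomial_eval n x)
  refine Finset.sum_congr rfl fun k hk => ?_
  rw [h1 k (Finset.mem_range_succ_iff.1 hk), mul_one]

/-- AM-GM in place of Cauchy–Schwarz: `2 |u| ≤ √m u² + 1 / √m`, then split `u = (t - c) + (c - x)`.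
The scale `√m` balances variances of order `1 / m`. -/
lemma abs_sub_le_sqrt_mul_sq {m : ℝ} (hm : 0 < m) (t c x : ℝ) :
    |t - x| ≤ √m * (t - c) ^ 2 + √m * (c - x) ^ 2 + 1 / √m := by
  have hs : 0 < √m := Real.sqrt_pos.2 hm
  have h₁ : (t - x) ^ 2 ≤ 2 * (t - c) ^ 2 + 2 * (c - x) ^ 2 := by
    nlinarith [sq_nonneg (t - c - (c - x))]
  have h₂ : 2 * |t - x| ≤ √m * (t - x) ^ 2 + 1 / √m := by
    have h : √m * (t - x) ^ 2 + 1 / √m - 2 * |t - x| = (√m * |t - x| - 1) ^ 2 / √m := by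
      rw [← sq_abs (t - x)]
      field_simp
      ring
    have : 0 ≤ (√m * |t - x| - 1) ^ 2 / √m := by positivity
    linarith
  have h₃ := mul_le_mul_of_nonneg_left h₁ hs.le
  have h₄ : 0 < 1 / √m := by positivity
  nlinarith

/-- If `μ k` is a probability density of variance `O(1 / n)` about `k / n`, then the first absolute
moment about `x` of the Bernstein mixture is `O(1 / √n)`. -/
lemma integral_bernsteinMixture_mul_abs_le (hn : n ≠ 0) (hx : x ∈ Icc (0 : ℝ) 1)
    (hμ : ∀ k, IntervalIntegrable (μ k) volume 0 1)
    (hμ0 : ∀ k, ∀ t ∈ Icc (0 : ℝ) 1, 0 ≤ μ k t)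
    (h1 : ∀ k ≤ n, ∫ t in (0 : ℝ)..1, μ k t = 1)
    (h2 : ∀ k ≤ n, ∫ t in (0 : ℝ)..1, μ k t * (t - k / n) ^ 2 ≤ 1 / n) :
    ∫ t in (0 : ℝ)..1, bernsteinMixture n μ x t * |t - x| ≤ 3 * (1 / √n) := by
  have hn' : (0 : ℝ) < n := by positivity
  have hs : 0 < √(n : ℝ) := Real.sqrt_pos.2 hn'
  have hsn : √(n : ℝ) * (1 / n) = 1 / √n := by
    rw [mul_one_div, Real.sqrt_div_self', one_div]
  have hterm : ∀ k ≤ n, ∫ t in (0 : ℝ)..1, μ k t * |t - x| ≤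
      1 / √n + √n * ((k : ℝ) / n - x) ^ 2 + 1 / √n := by
    intro k hk
    have hi : IntervalIntegrable (fun t => μ k t * (t - k / n) ^ 2) volume 0 1 :=
      (hμ k).mul_continuousOn (by fun_prop)
    calc ∫ t in (0 : ℝ)..1, μ k t * |t - x|
        ≤ ∫ t in (0 : ℝ)..1, (√n * (μ k t * (t - k / n) ^ 2) +
            (√n * ((k : ℝ) / n - x) ^ 2 + 1 / √n) * μ k t) := by
          refine intervalIntegral.integral_mono_on zero_le_one
            ((hμ k).mul_continuousOn (by fun_prop))
            ((hi.const_mul _).add ((hμ k).const_mul _)) fun t ht => ?_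
          refine (mul_le_mul_of_nonneg_left (abs_sub_le_sqrt_mul_sq hn' t (k / n) x)
            (hμ0 k t ht)).trans_eq ?_
          ring
      _ = √n * (∫ t in (0 : ℝ)..1, μ k t * (t - k / n) ^ 2) +
            (√n * ((k : ℝ) / n - x) ^ 2 + 1 / √n) := by
          rw [intervalIntegral.integral_add (hi.const_mul _) ((hμ k).const_mul _),
            intervalIntegral.integral_const_mul, intervalIntegral.integral_const_mul, h1 k hk,
            mul_one]
      _ ≤ √n * (1 / n) + (√n * ((k : ℝ) / n - x) ^ 2 + 1 / √n) := by
          gcongr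
          exact h2 k hk
      _ = _ := by rw [hsn, add_assoc]
  rw [integral_bernsteinMixture_mul (by fun_prop) hμ]
  calc _ ≤ ∑ k ∈ Finset.range (n + 1), (bernsteinPolynomial ℝ n k).eval x *
        (1 / √n + √n * ((k : ℝ) / n - x) ^ 2 + 1 / √n) :=
        Finset.sum_le_sum fun k hk => mul_le_mul_of_nonneg_left
          (hterm k (Finset.mem_range_succ_iff.1 hk)) (bernsteinPolynomial_eval_nonneg n k hx)
    _ = (∑ k ∈ Finset.range (n + 1), (bernsteinPolynomial ℝ n k).eval x) * (2 * (1 / √n)) +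
        √n * ∑ k ∈ Finset.range (n + 1),
          (bernsteinPolynomial ℝ n k).eval x * ((k : ℝ) / n - x) ^ 2 := by
        rw [Finset.sum_mul, Finset.mul_sum, ← Finset.sum_add_distrib]
        exact Finset.sum_congr rfl fun k _ => by ring
    _ = 2 * (1 / √n) + √n * (x * (1 - x) / n) := by
        rw [sum_bernsteinPolynomial_eval, sum_bernsteinPolynomial_eval_mul_sq hn, one_mul]
    -- One `1 / √n` each comes from the densities, from AM-GM and from the Bernstein weights.
    _ ≤ 2 * (1 / √n) + √n * (1 / n) := by
        gcongr
        nlinarith [hx.1, hx.2]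
    _ = 3 * (1 / √n) := by
        rw [hsn]
        ring

end BernsteinMixture

/-! ### The Durrmeyer and Kantorovich densities. -/

section Kernels

variable {n k : ℕ}

/-- The probability densities whose Bernstein mixture is the Durrmeyer kernel. -/
def durrmeyerDensity (n k : ℕ) (t : ℝ) : ℝ :=
  (n + 1) * (bernsteinPolynomial ℝ n k).eval t

/-- The probability densities whose Bernstein mixture is the Kantorovich kernel. -/
def kantorovichDensity (n k : ℕ) (t : ℝ) : ℝ :=
  (n + 1) * (Icc ((k : ℝ) / (n + 1)) (((k : ℝ) + 1) / (n + 1))).indicator (fun _ => (1 : ℝ)) t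

lemma durrmeyerKernel_eq (n : ℕ) (x : ℝ) :
    durrmeyerKernel n x = bernsteinMixture n (durrmeyerDensity n) x := by
  ext t
  simp only [durrmeyerKernel, bernsteinMixture, durrmeyerDensity, Finset.mul_sum, mul_left_comm]

lemma kantorovichKernel_eq (n : ℕ) (x : ℝ) :
    kantorovichKernel n x = bernsteinMixture n (kantorovichDensity n) x := by
  ext t
  simp only [kantorovichKernel, bernsteinMixture, kantorovichDensity, Finset.mul_sum,
    mul_left_comm]

lemma continuous_durrmeyerDensity (n k : ℕ) : Continuous (durrmeyerDensity n k) :=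
  continuous_const.mul (Polynomial.continuous _)

lemma integral_durrmeyerDensity (hk : k ≤ n) :
    ∫ t in (0 : ℝ)..1, durrmeyerDensity n k t = 1 := by
  simp only [durrmeyerDensity]
  rw [intervalIntegral.integral_const_mul, integral_bernsteinPolynomial hk]
  field_simp

lemma kantorovichDensity_nonneg (n k : ℕ) (t : ℝ) : 0 ≤ kantorovichDensity n k t :=
  mul_nonneg (by positivity) (indicator_nonneg (fun _ _ => zero_le_one) _)

lemma kantorovichDensity_le (n k : ℕ) (t : ℝ) : kantorovichDensity n k t ≤ n + 1 :=
  mul_le_of_le_one_right (by positivity) (indicator_le_self' (fun _ _ => zero_le_one) _)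

lemma ae_continuousAt_kantorovichDensity (n k : ℕ) :
    ∀ᵐ t, ContinuousAt (kantorovichDensity n k) t := by
  have h : ∀ c : ℝ, ∀ᵐ t : ℝ, t ≠ c := fun c => by simp [ae_iff]
  filter_upwards [h ((k : ℝ) / (n + 1)), h (((k : ℝ) + 1) / (n + 1))] with t h₁ h₂
  refine ContinuousAt.const_mul ?_ _
  refine continuousOn_const.continuousAt_indicator fun ht => ?_
  rw [frontier_Icc (by gcongr; linarith)] at ht
  rcases ht with rfl | rfl
  · exact h₁ rfl
  · exact h₂ rfl

lemma intervalIntegrable_kantorovichDensity (n k : ℕ) :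
    IntervalIntegrable (kantorovichDensity n k) volume 0 1 := by
  refine IntervalIntegrable.const_mul ?_ _
  rw [intervalIntegrable_iff]
  exact (integrableOn_const (by simp)).indicator measurableSet_Icc

lemma integral_kantorovichDensity_mul (hk : k ≤ n) (g : ℝ → ℝ) :
    ∫ t in (0 : ℝ)..1, kantorovichDensity n k t * g t =
      (n + 1) * ∫ t in ((k : ℝ) / (n + 1))..(((k : ℝ) + 1) / (n + 1)), g t := by
  have hk' : (k : ℝ) ≤ n := by exact_mod_cast hk
  have hle : (k : ℝ) / (n + 1) ≤ ((k : ℝ) + 1) / (n + 1) := by gcongr; linarith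
  have hsub : Icc ((k : ℝ) / (n + 1)) (((k : ℝ) + 1) / (n + 1)) ⊆ Icc 0 1 :=
    Icc_subset_Icc (by positivity) (div_le_one_of_le₀ (by linarith) (by positivity))
  have h : ∀ t, kantorovichDensity n k t * g t =
      (n + 1) * (Icc ((k : ℝ) / (n + 1)) (((k : ℝ) + 1) / (n + 1))).indicator g t := by
    intro t
    by_cases ht : t ∈ Icc ((k : ℝ) / (n + 1)) (((k : ℝ) + 1) / (n + 1)) <;>
      simp [kantorovichDensity, ht]
  simp only [h]
  rw [intervalIntegral.integral_const_mul, intervalIntegral.integral_of_le zero_le_one,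
    intervalIntegral.integral_of_le hle, ← integral_Icc_eq_integral_Ioc,
    ← integral_Icc_eq_integral_Ioc, setIntegral_indicator measurableSet_Icc,
    inter_eq_self_of_subset_right hsub]

lemma integral_kantorovichDensity (hk : k ≤ n) :
    ∫ t in (0 : ℝ)..1, kantorovichDensity n k t = 1 := by
  have h := integral_kantorovichDensity_mul hk fun _ => 1
  simp only [mul_one, intervalIntegral.integral_const, smul_eq_mul] at h
  rw [h]
  field_simp
  ring

/-- Since `k ≤ n`, the point `k / n` lies in the supporting interval of length `1 / (n + 1)`, so `|t
- k / n|` is at most that length there. -/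
lemma integral_kantorovichDensity_mul_sq_le (hn : n ≠ 0) (hk : k ≤ n) :
    ∫ t in (0 : ℝ)..1, kantorovichDensity n k t * (t - k / n) ^ 2 ≤ 1 / n := by
  have hn' : (0 : ℝ) < n := by positivity
  have hk' : (k : ℝ) ≤ n := by exact_mod_cast hk
  have hle : (k : ℝ) / (n + 1) ≤ ((k : ℝ) + 1) / (n + 1) := by gcongr; linarith
  have h₁ : (k : ℝ) / (n + 1) ≤ k / n := by gcongr; linarith
  have h₂ : (k : ℝ) / n ≤ (k + 1) / (n + 1) := by
    rw [div_le_div_iff₀ hn' (by positivity)]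
    linarith
  have hd : ((k : ℝ) + 1) / (n + 1) - k / (n + 1) = 1 / (n + 1) := by ring
  rw [integral_kantorovichDensity_mul hk]
  calc _ ≤ ((n : ℝ) + 1) * ∫ t in ((k : ℝ) / (n + 1))..(((k : ℝ) + 1) / (n + 1)),
        (1 / ((n : ℝ) + 1)) ^ 2 := by
        gcongr
        refine intervalIntegral.integral_mono_on hle
          (Continuous.intervalIntegrable (by fun_prop) _ _) (by simp) fun t ht => ?_
        rw [← sq_abs (t - k / n)]
        gcongr
        exact abs_le.2 ⟨by linarith [ht.1], by linarith [ht.2]⟩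
    _ = (1 / ((n : ℝ) + 1)) ^ 2 := by
        rw [intervalIntegral.integral_const, hd, smul_eq_mul]
        field_simp
    _ ≤ 1 / n := by
        rw [div_pow, one_pow]
        gcongr
        nlinarith

end Kernels

/-! ### Rate of approximation of the operators. -/

section Operators

variable {E : Type*} [NormedAddCommGroup E] [NormedSpace ℝ E] [ProperSpace E] {x : ℝ}
  {F : ℝ → NonemptyCompacts E}

/-- `C` depends on `F` and `x` but not on the weight, so one constant serves all `n`. -/
lemma exists_approx_of_locallyLipschitz
    (hF : IsCompact {p : ℝ × E | p.1 ∈ Icc (0 : ℝ) 1 ∧ p.2 ∈ F p.1}) (hx : x ∈ Icc (0 : ℝ) 1)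
    (hLip : LocallyLipschitzAround 0 1 F x) :
    ∃ C ≥ (0 : ℝ), ∀ κ : ℝ → ℝ, ∀ M : ℝ, (∀ t ∈ Icc (0 : ℝ) 1, κ t ≤ M) →
      (∀ t ∈ Icc (0 : ℝ) 1, 0 ≤ κ t) → (∀ᵐ t, ContinuousAt κ t) →
      ∫ t in (0 : ℝ)..1, κ t = 1 →
      (weightedMetricIntegral 0 1 κ F).Nonempty ∧ IsCompact (weightedMetricIntegral 0 1 κ F) ∧
        hausdorffDist (weightedMetricIntegral 0 1 κ F) (F x) ≤
          C * ∫ t in (0 : ℝ)..1, κ t * |t - x| := by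
  obtain ⟨L, hL, δ, hδ, h⟩ := hLip
  obtain ⟨R, hR⟩ := (hF.image continuous_snd).isBounded.exists_norm_le
  have hR' : ∀ t ∈ Icc (0 : ℝ) 1, ∀ p ∈ F t, ‖p‖ ≤ R := fun t ht p hp => hR p ⟨(t, p), ⟨ht, hp⟩, rfl⟩
  obtain ⟨p, hp⟩ := (F x).nonempty
  have hR0 : 0 ≤ R := (norm_nonneg p).trans (hR' x hx p hp)
  refine ⟨L + 4 * R / δ, by positivity, fun κ M hM hκ hκc hκ1 => ?_⟩
  exact weightedMetricIntegral_approx zero_lt_one hx (by positivity) hR'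
    (fun t ht => dist_le_of_locallyLipschitz hL.le hδ hR' h hx ht)
    (fun χ y hy i hi j hj => dist_metricChain_le hL.le hδ hR' h χ hy hi hj)
    (fun t ht => (abs_of_nonneg (hκ t ht)).trans_le (hM t ht)) hκ hκc hκ1

/-- The set-valued operators whose kernels are Bernstein mixtures of probability densities `μ n k`
with variances `O(1 / n)` about `k / n` approximate with the rate `O(1 / √n)`. -/
theorem bernsteinMixture_approx
    (hF : IsCompact {p : ℝ × E | p.1 ∈ Icc (0 : ℝ) 1 ∧ p.2 ∈ F p.1}) (hx : x ∈ Icc (0 : ℝ) 1)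
    (hLip : LocallyLipschitzAround 0 1 F x) {μ : ℕ → ℕ → ℝ → ℝ}
    (hμ : ∀ n k, IntervalIntegrable (μ n k) volume 0 1)
    (hμc : ∀ n k, ∀ᵐ t, ContinuousAt (μ n k) t)
    (hμ0 : ∀ n k, ∀ t ∈ Icc (0 : ℝ) 1, 0 ≤ μ n k t)
    (hμM : ∀ n k, ∀ t ∈ Icc (0 : ℝ) 1, μ n k t ≤ n + 1)
    (h1 : ∀ n, ∀ k ≤ n, ∫ t in (0 : ℝ)..1, μ n k t = 1)
    (h2 : ∀ n, n ≠ 0 → ∀ k ≤ n, ∫ t in (0 : ℝ)..1, μ n k t * (t - k / n) ^ 2 ≤ 1 / n) :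
    (∀ n : ℕ, 1 ≤ n → (weightedMetricIntegral 0 1 (bernsteinMixture n (μ n) x) F).Nonempty ∧
        IsCompact (weightedMetricIntegral 0 1 (bernsteinMixture n (μ n) x) F)) ∧
      (fun n : ℕ => hausdorffDist (weightedMetricIntegral 0 1 (bernsteinMixture n (μ n) x) F)
        (F x : Set E)) =O[atTop] fun n : ℕ => 1 / √(n : ℝ) := by
  obtain ⟨C, hC, h⟩ := exists_approx_of_locallyLipschitz hF hx hLip
  have h' := fun n => h (bernsteinMixture n (μ n) x) (n + 1)
    (fun t ht => bernsteinMixture_le hx fun k => hμM n k t ht)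
    (fun t ht => bernsteinMixture_nonneg hx fun k => hμ0 n k t ht)
    (ae_continuousAt_bernsteinMixture (hμc n)) (integral_bernsteinMixture (hμ n) (h1 n))
  refine ⟨fun n _ => ⟨(h' n).1, (h' n).2.1⟩, Asymptotics.IsBigO.of_bound (C * 3) ?_⟩
  filter_upwards [eventually_ne_atTop 0] with n hn
  rw [Real.norm_of_nonneg hausdorffDist_nonneg, Real.norm_of_nonneg (by positivity), mul_assoc]
  exact (h' n).2.2.trans <| mul_le_mul_of_nonneg_left
    (integral_bernsteinMixture_mul_abs_le hn hx (hμ n) (hμ0 n) (h1 n) (h2 n hn)) hC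

end Operators

end MetricApprox

end

theorem mainTheorem5 {E : Type*} [NormedAddCommGroup E] [NormedSpace ℝ E] [FiniteDimensional ℝ E]
    (F : ℝ → TopologicalSpace.NonemptyCompacts E) (hF : MetricApprox.IsBVCompactGraph 0 1 F)
    (x : ℝ) (hx : x ∈ Set.Icc (0 : ℝ) 1)
    (hLip : MetricApprox.LocallyLipschitzAround 0 1 F x) :
    ((∀ n : ℕ, 1 ≤ n →
        (MetricApprox.durrmeyerOp n F x).Nonempty ∧ IsCompact (MetricApprox.durrmeyerOp n F x)) ∧
      (fun n : ℕ => Metric.hausdorffDist (MetricApprox.durrmeyerOp n F x) (F x : Set E))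
        =O[Filter.atTop] fun n : ℕ => 1 / Real.sqrt (n : ℝ)) ∧
    ((∀ n : ℕ, 1 ≤ n →
        (MetricApprox.kantorovichOp n F x).Nonempty ∧
          IsCompact (MetricApprox.kantorovichOp n F x)) ∧
      (fun n : ℕ => Metric.hausdorffDist (MetricApprox.kantorovichOp n F x) (F x : Set E))
        =O[Filter.atTop] fun n : ℕ => 1 / Real.sqrt (n : ℝ)) := by

  have : ProperSpace E := FiniteDimensional.proper ℝ E
  constructor
  · simp only [MetricApprox.durrmeyerOp, MetricApprox.durrmeyerKernel_eq]
    exact MetricApprox.bernsteinMixture_approx hF.2 hx hLip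
      (fun n k => (MetricApprox.continuous_durrmeyerDensity n k).intervalIntegrable _ _)
      (fun n k => Filter.Eventually.of_forall fun t =>
        (MetricApprox.continuous_durrmeyerDensity n k).continuousAt)
      (fun n k t ht =>
        mul_nonneg (by positivity) (MetricApprox.bernsteinPolynomial_eval_nonneg n k ht))
      (fun n k t ht => mul_le_of_le_one_right (by positivity)
        (MetricApprox.bernsteinPolynomial_eval_le_one n k ht))
      (fun n k hk => MetricApprox.integral_durrmeyerDensity hk)
      (fun n hn k hk => MetricApprox.integral_bernsteinPolynomial_mul_sq_le hn hk)
  · simp only [MetricApprox.kantorovichOp, MetricApprox.kantorovichKernel_eq]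
    exact MetricApprox.bernsteinMixture_approx hF.2 hx hLip
      MetricApprox.intervalIntegrable_kantorovichDensity
      MetricApprox.ae_continuousAt_kantorovichDensity
      (fun n k t _ => MetricApprox.kantorovichDensity_nonneg n k t)
      (fun n k t _ => MetricApprox.kantorovichDensity_le n k t)
      (fun n k hk => MetricApprox.integral_kantorovichDensity hk)
      (fun n hn k hk => MetricApprox.integral_kantorovichDensity_mul_sq_le hn hk)
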